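/- Let $G$ be a compact (Hausdorff) vector space over $\mathbb{F}_2$, with Haar measure $\mu_G$ normalised so that $\mu_G(G)=1$, and let $\widehat{G}$ be its dual group, i.e. the group of continuous homomorphisms from $G$ to $S^1=\{z\in\mathbb{C}:|z|=1\}$. For $f\in L^1(G)$ and $\gamma\in\widehat{G}$ write $\widehat{f}(\gamma)=\int_G f(x)\overline{\gamma(x)}\,d\mu_G(x)$ and $\|f\|_{A(G)}=\sum_{\gamma\in\widehat{G}}|\widehat{f}(\gamma)|\in[0,\infty]$, and let $A(G)=\{f\in L^1(G):\|f\|_{A(G)}<\infty\}$. There is an absolute constant $c>0$ such that the following holds for every such $G$ and every $\mu_G$-measurable set $A\subset G$ with density $\alpha=\mu_G(A)$ and characteristic function $\chi_A$. If $0<\epsilon<1/3$ and $|\alpha-1/3|\le\epsilon$, then $$\|\chi_A\|_{A(G)}\ \ge\ c\,\log\log\epsilon^{-1}.$$ In particular, if $\alpha=1/3$ then $\chi_A\notin A(G)$. -/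

import Mathlib

open MeasureTheory
open scoped ENNReal

noncomputable section

namespace CompactF2

/-- The Haar measure of a compact (additive) group `G`, normalised so that `G` has measure `1`. -/
def haarProb (G : Type*) [AddCommGroup G] [TopologicalSpace G] [IsTopologicalAddGroup G]
    [CompactSpace G] [MeasurableSpace G] [BorelSpace G] : Measure G :=
  Measure.addHaarMeasure (⊤ : TopologicalSpace.PositiveCompacts G)

/-- The dual group: continuous homomorphisms from the additive group `G` to the unit circle.
Mathlib's Pontryagin dual is written for multiplicative groups, hence `Multiplicative G`. -/
abbrev Dual (G : Type*) [AddCommGroup G] [TopologicalSpace G] : Type _ :=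
  PontryaginDual (Multiplicative G)

variable {G : Type*} [AddCommGroup G] [TopologicalSpace G] [IsTopologicalAddGroup G]
  [CompactSpace G] [MeasurableSpace G] [BorelSpace G]

/-- The Fourier transform `γ ↦ ∫ f(x) conj(γ(x)) dμ_G(x)`. -/
def dualTransform (f : G → ℂ) (γ : Dual G) : ℂ :=
  ∫ x, f x * (starRingEnd ℂ) (γ (Multiplicative.ofAdd x) : ℂ) ∂(haarProb G)

/-- The `ℓ¹` norm of the Fourier transform of an integrable function, with value `∞` when the
transform is not summable. -/
def algNorm (f : G → ℂ) : ℝ≥0∞ := ∑' γ : Dual G, ‖dualTransform f γ‖ₑ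

/-- Membership in `A(G)`: integrable functions with absolutely summable Fourier transform. -/
def MemA (f : G → ℂ) : Prop := Integrable f (haarProb G) ∧ algNorm f < ∞

/-- The characteristic function of `A`. -/
def chi (A : Set G) : G → ℂ := A.indicator (fun _ => 1)

end CompactF2

end

/-!
The Fourier algebra norm `M` of a set of density close to `1 / 3` is bounded below by an increment
argument in the dual group. A finite subgroup `S` of the dual, of order `2 ^ d`, cuts the group
into cosets of its annihilator, each of measure `2⁻ᵈ`. Since `1 / 3` is at distance at least
`2⁻ᵈ / 3` from the multiples of `2⁻ᵈ`, as long as `ε` is small compared with `2⁻ᵈ` there is a coset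
on which the relative density of `A` is at distance at least `2⁻ᵈ / 4` from `0` and `1`
(`WalshSystem.exists_balanced_cell`). Let `B` be the smaller of `A` and its complement inside that
coset. The coefficients of the indicator of `A` at `S` account only for the average of `A` on the
coset, so Parseval's identity gives
`∑ γ ∉ S, |Â γ| * |B̂ γ| / μ B ≥ 1 / 2` (`WalshSystem.half_le_tsum_compl`).

A dyadic pigeonhole (`exists_dyadic_level`) finds a `k ≥ 1` such that the characters `γ ∉ S` with
`|B̂ γ| ≥ 2⁻ᵏ μ B` carry at least `k / 16` of `∑ |Â γ|`. By Chang's theorem relative to the coset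
(`WalshSystem.exists_subgroup_of_large_coeff`) these characters lie in a subgroup containing `S`
whose dimension is larger than `d` by a factor of order at most `16 ^ k`. Thus the logarithm of the
dimension grows at most linearly in the mass gained. The total mass is `M`, so the procedure stops
at a dimension `d` with `log (d + 2)` of order at most `M`, and stopping means that `2 ^ d` exceeds
a constant times `1 / ε`.

This part of the argument uses only a group of `±1`-valued functions satisfying Parseval's identity
(`WalshSystem`). That the characters of a compact vector space over `𝔽₂` form such a system amounts
to their separating points, as in the Peter–Weyl theorem: for `g ≠ 0` take a nonzero continuous `u`
with `u (x + g) = -u x`. The operator with kernel `u (x + y)` is compact and self-adjoint, so it has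
a nonzero finite-dimensional space of continuous eigenfunctions. The translations act on it by
commuting involutions, and a common eigenvector is a multiple of a character equal to `-1` at `g`
(`CompactF2.exists_dual_eq_neg_one`).
-/

/-! ### Walsh systems -/

/-- An abstract Walsh system on a measure space: a group `Γ` of exponent two acting as a group of
`±1`-valued functions (the values `±1` are forced by `mul_self`), nontrivial elements having mean
zero, for which Parseval's identity holds for indicator functions. The characters of a compact
vector space over `𝔽₂` form such a system; no group structure on the underlying space is used. -/
structure WalshSystem {X : Type*} [MeasurableSpace X] (μ : Measure X) (Γ : Type*)
    [CommGroup Γ] where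
  /-- The function attached to an element of `Γ`. -/
  char : Γ →* (X → ℝ)
  mul_self : ∀ γ : Γ, γ * γ = 1
  measurable_char : ∀ γ, Measurable (char γ)
  integral_char : ∀ γ, γ ≠ 1 → ∫ x, char γ x ∂μ = 0
  hasSum_setIntegral_mul : ∀ A B : Set X, MeasurableSet A → MeasurableSet B →
    HasSum (fun γ => (∫ x in A, char γ x ∂μ) * ∫ x in B, char γ x ∂μ) (μ.real (A ∩ B))

/-- A finite subgroup of a group of exponent two, as a finset (inverses are automatic). -/
structure IsFinsetSubgroup {Γ : Type*} [CommGroup Γ] (S : Finset Γ) : Prop where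
  one_mem : 1 ∈ S
  mul_mem : ∀ a ∈ S, ∀ b ∈ S, a * b ∈ S

lemma IsFinsetSubgroup.exists_insert {Γ : Type*} [CommGroup Γ] (hΓ : ∀ γ : Γ, γ * γ = 1)
    {S : Finset Γ} (hS : IsFinsetSubgroup S) {γ : Γ} (hγ : γ ∉ S) :
    ∃ T : Finset Γ, IsFinsetSubgroup T ∧ S ⊆ T ∧ (∀ s ∈ S, γ * s ∈ T) ∧ T.card = 2 * S.card := by
  classical
  refine ⟨S ∪ S.image (γ * ·), ⟨Finset.mem_union_left _ hS.one_mem, ?_⟩,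
    Finset.subset_union_left, fun s hs => Finset.mem_union_right _ (Finset.mem_image_of_mem _ hs),
    ?_⟩
  · simp only [Finset.mem_union, Finset.mem_image]
    rintro a (ha | ⟨a, ha, rfl⟩) b (hb | ⟨b, hb, rfl⟩)
    · exact Or.inl (hS.mul_mem a ha b hb)
    · exact Or.inr ⟨a * b, hS.mul_mem a ha b hb, by rw [mul_left_comm]⟩
    · exact Or.inr ⟨a * b, hS.mul_mem a ha b hb, by rw [mul_assoc]⟩
    · refine Or.inl ?_
      rw [mul_mul_mul_comm, hΓ, one_mul]
      exact hS.mul_mem a ha b hb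
  · rw [Finset.card_union_of_disjoint, Finset.card_image_of_injective _ (mul_right_injective γ),
      two_mul]
    rw [Finset.disjoint_left]
    intro a ha ha'
    obtain ⟨b, hb, rfl⟩ := Finset.mem_image.mp ha'
    apply hγ
    have := hS.mul_mem _ ha b hb
    rwa [mul_assoc, hΓ, mul_one] at this

namespace WalshSystem

variable {X : Type*} [MeasurableSpace X] {μ : Measure X} {Γ : Type*} [CommGroup Γ]
  (W : WalshSystem μ Γ)

/-- The Walsh coefficient at `γ` of the indicator function of `A`. -/
noncomputable def coeff (A : Set X) (γ : Γ) : ℝ := ∫ x in A, W.char γ x ∂μ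

/-- The set of points on which all functions in `S` take the same values as at `x`; for characters
of a group this is the coset of the annihilator of `S` through `x`. -/
def cell (S : Finset Γ) (x : X) : Set X := {y | ∀ s ∈ S, W.char s y = W.char s x}

/-- The linear span of the functions in `S`. -/
def poly (S : Finset Γ) : Submodule ℝ (X → ℝ) := Submodule.span ℝ (W.char '' S)

lemma char_mul (γ δ : Γ) (x : X) : W.char (γ * δ) x = W.char γ x * W.char δ x := by
  rw [map_mul, Pi.mul_apply]

lemma char_one (x : X) : W.char 1 x = 1 := by rw [map_one, Pi.one_apply]

lemma char_mul_char_self (γ : Γ) (x : X) : W.char γ x * W.char γ x = 1 := by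
  rw [← char_mul, W.mul_self, char_one]

lemma char_eq_or (γ : Γ) (x : X) : W.char γ x = 1 ∨ W.char γ x = -1 :=
  mul_self_eq_one_iff.mp (W.char_mul_char_self γ x)

lemma abs_char (γ : Γ) (x : X) : |W.char γ x| = 1 := by
  rcases W.char_eq_or γ x with h | h <;> simp [h]

lemma measurableSet_cell (S : Finset Γ) (x : X) : MeasurableSet (W.cell S x) := by
  have : W.cell S x = ⋂ s ∈ S, {y | W.char s y = W.char s x} := by ext; simp [cell]
  rw [this]
  exact Finset.measurableSet_biInter _ fun s _ =>
    measurableSet_eq_fun (W.measurable_char s) measurable_const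

/-- Orthogonality of the characters of the finite group `S`. -/
lemma sum_char_mul_char {S : Finset Γ} (hS : IsFinsetSubgroup S) (x y : X) :
    ∑ s ∈ S, W.char s x * W.char s y = (W.cell S x).indicator (fun _ => (S.card : ℝ)) y := by
  classical
  by_cases hy : y ∈ W.cell S x
  · rw [Set.indicator_of_mem hy, Finset.sum_congr rfl (g := fun _ => (1 : ℝ))]
    · simp
    · intro s hs
      rw [hy s hs, W.char_mul_char_self]
  · rw [Set.indicator_of_notMem hy]
    simp only [cell, Set.mem_ofPred_eq, not_forall] at hy
    obtain ⟨t, ht, hne⟩ := hy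
    have hneg : W.char t x * W.char t y = -1 := by
      rcases W.char_eq_or t x with h | h <;> rcases W.char_eq_or t y with h' | h' <;>
        simp_all
    -- multiplication by `t` permutes `S` and changes the sign of every term
    have hinv : ∑ s ∈ S, W.char s x * W.char s y
        = ∑ s ∈ S, W.char (t * s) x * W.char (t * s) y := by
      refine Finset.sum_nbij' (fun s => t * s) (fun s => t * s) (fun s hs => hS.mul_mem t ht s hs)
        (fun s hs => hS.mul_mem t ht s hs) (fun s _ => ?_) (fun s _ => ?_) (fun s _ => ?_)
      · rw [← mul_assoc, W.mul_self, one_mul]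
      · rw [← mul_assoc, W.mul_self, one_mul]
      · rw [← mul_assoc, W.mul_self, one_mul]
    have : ∑ s ∈ S, W.char (t * s) x * W.char (t * s) y
        = -∑ s ∈ S, W.char s x * W.char s y := by
      rw [← Finset.sum_neg_distrib]
      refine Finset.sum_congr rfl fun s _ => ?_
      rw [char_mul, char_mul]
      linear_combination (W.char s x * W.char s y) * hneg
    linarith

lemma poly_mono {S T : Finset Γ} (h : S ⊆ T) : W.poly S ≤ W.poly T :=
  Submodule.span_mono (Set.image_mono (by exact_mod_cast h))

lemma char_mem_poly {S : Finset Γ} {γ : Γ} (h : γ ∈ S) : W.char γ ∈ W.poly S :=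
  Submodule.subset_span ⟨γ, h, rfl⟩

lemma indicator_cell_mem_poly {S : Finset Γ} (hS : IsFinsetSubgroup S) (x : X) :
    (W.cell S x).indicator (fun _ => (1 : ℝ)) ∈ W.poly S := by
  have hcard : (S.card : ℝ) ≠ 0 := by
    exact_mod_cast (Finset.card_pos.mpr ⟨1, hS.one_mem⟩).ne'
  have : (W.cell S x).indicator (fun _ => (1 : ℝ))
      = (S.card : ℝ)⁻¹ • ∑ s ∈ S, W.char s x • W.char s := by
    ext y
    have := W.sum_char_mul_char hS x y
    simp only [Pi.smul_apply, Finset.sum_apply, smul_eq_mul, this]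
    by_cases hy : y ∈ W.cell S x <;> simp [hy, hcard]
  rw [this]
  exact Submodule.smul_mem _ _ (Submodule.sum_mem _ fun s hs =>
    Submodule.smul_mem _ _ (W.char_mem_poly hs))

lemma mul_char_mem_poly {S T : Finset Γ} {γ : Γ} (hST : ∀ s ∈ S, γ * s ∈ T) {h : X → ℝ}
    (hh : h ∈ W.poly S) : h * W.char γ ∈ W.poly T := by
  induction hh using Submodule.span_induction with
  | mem f hf =>
    obtain ⟨s, hs, rfl⟩ := hf
    rw [← map_mul, mul_comm]
    exact W.char_mem_poly (hST s hs)
  | zero => rw [zero_mul]; exact Submodule.zero_mem _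
  | add f g _ _ hf hg => rw [add_mul]; exact Submodule.add_mem _ hf hg
  | smul c f _ hf => rw [smul_mul_assoc]; exact Submodule.smul_mem _ _ hf

lemma integrable_char [IsProbabilityMeasure μ] (γ : Γ) : Integrable (W.char γ) μ :=
  Integrable.of_bound (W.measurable_char γ).aestronglyMeasurable 1
    (Filter.Eventually.of_forall fun x => (W.abs_char γ x).le)

lemma integrable_of_mem_poly [IsProbabilityMeasure μ] {S : Finset Γ} {h : X → ℝ} (hh : h ∈ W.poly S) :
    Integrable h μ := by
  induction hh using Submodule.span_induction with
  | mem f hf =>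
    obtain ⟨s, -, rfl⟩ := hf
    exact W.integrable_char s
  | zero => exact integrable_zero _ _ _
  | add f g _ _ hf hg => exact hf.add hg
  | smul c f _ hf => exact hf.smul c

lemma integral_mul_char_eq_zero [IsProbabilityMeasure μ] {S : Finset Γ} {γ : Γ} (hγ : γ ∉ S) {h : X → ℝ}
    (hh : h ∈ W.poly S) : Integrable (h * W.char γ) μ ∧ ∫ x, (h * W.char γ) x ∂μ = 0 := by
  induction hh using Submodule.span_induction with
  | mem f hf =>
    obtain ⟨s, hs, rfl⟩ := hf
    rw [← map_mul]
    refine ⟨W.integrable_char _, W.integral_char _ fun h1 => hγ ?_⟩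
    have : γ = s := by
      rw [← one_mul γ, ← W.mul_self s, mul_assoc, h1, mul_one]
    exact this ▸ hs
  | zero => rw [zero_mul]; simp
  | add f g _ _ hf hg =>
    rw [add_mul]
    refine ⟨hf.1.add hg.1, ?_⟩
    simp only [Pi.add_apply]
    rw [integral_add hf.1 hg.1, hf.2, hg.2, add_zero]
  | smul c f _ hf =>
    rw [smul_mul_assoc]
    refine ⟨hf.1.smul c, ?_⟩
    simp only [Pi.smul_apply]
    rw [integral_smul, hf.2, smul_zero]

lemma sum_char_mul_coeff [IsProbabilityMeasure μ] {S : Finset Γ} (hS : IsFinsetSubgroup S) (A : Set X) (x : X) :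
    ∑ s ∈ S, W.char s x * W.coeff A s = S.card * μ.real (A ∩ W.cell S x) := by
  simp only [coeff]
  simp_rw [← integral_const_mul]
  rw [← integral_finsetSum _ fun s _ => ((W.integrable_char s).integrableOn.const_mul _)]
  simp_rw [W.sum_char_mul_char hS]
  rw [setIntegral_indicator (W.measurableSet_cell S x), setIntegral_const, smul_eq_mul, mul_comm]

lemma coeff_univ_of_ne {γ : Γ} (h : γ ≠ 1) : W.coeff Set.univ γ = 0 := by
  rw [coeff, setIntegral_univ, W.integral_char γ h]

lemma coeff_one (A : Set X) : W.coeff A 1 = μ.real A := by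
  simp [coeff]

lemma card_mul_measure_cell [IsProbabilityMeasure μ] {S : Finset Γ} (hS : IsFinsetSubgroup S) (x : X) :
    S.card * μ.real (W.cell S x) = 1 := by
  have := W.sum_char_mul_coeff hS Set.univ x
  rw [Set.univ_inter] at this
  rw [← this, Finset.sum_eq_single 1]
  · rw [coeff_one, char_one]; simp
  · intro s _ hs
    rw [W.coeff_univ_of_ne hs, mul_zero]
  · exact fun h => absurd hS.one_mem h

lemma abs_coeff_le [IsProbabilityMeasure μ] (A : Set X) (γ : Γ) : |W.coeff A γ| ≤ μ.real A := by
  have := norm_setIntegral_le_of_norm_le_const (μ := μ) (s := A) (f := W.char γ) (C := 1)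
    (measure_lt_top _ _) (fun x _ => (W.abs_char γ x).le)
  simpa [coeff] using this

lemma coeff_of_subset_cell {S : Finset Γ} {x : X} {B : Set X} (hBm : MeasurableSet B)
    (hB : B ⊆ W.cell S x) {s : Γ} (hs : s ∈ S) : W.coeff B s = W.char s x * μ.real B := by
  rw [coeff, setIntegral_congr_fun hBm (g := fun _ => W.char s x) (fun y hy => hB hy s hs)]
  rw [setIntegral_const, smul_eq_mul, mul_comm]

/-! ### Chang's theorem on a cell -/

/-- The data carried through the greedy construction behind Chang's theorem: a subgroup `T` of
index `2 ^ k` over `S` together with an exponential sum `exp g` (agreeing with a Riesz product `h`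
on the cell of `x`) whose integral over the cell is at most `exp (k ρ² / 2)` times the measure of
the cell, while `g` has mean at least `k ρ²` on `B`. -/
def RieszStep (S : Finset Γ) (x : X) (B : Set X) (ρ : ℝ) (k : ℕ) (T : Finset Γ) : Prop :=
  IsFinsetSubgroup T ∧ S ⊆ T ∧ T.card = S.card * 2 ^ k ∧ ∃ g h : X → ℝ,
    g ∈ W.poly T ∧ h ∈ W.poly T ∧ (∀ y ∈ W.cell S x, h y = Real.exp (g y)) ∧
    (∀ y ∉ W.cell S x, h y = 0) ∧
    ∫ y, h y ∂μ ≤ Real.exp (k * ρ ^ 2 / 2) * μ.real (W.cell S x) ∧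
    k * ρ ^ 2 * μ.real B ≤ ∫ y in B, g y ∂μ

lemma rieszStep_zero {S : Finset Γ} (hS : IsFinsetSubgroup S) (x : X) (B : Set X) (ρ : ℝ) :
    W.RieszStep S x B ρ 0 S := by
  refine ⟨hS, subset_rfl, by simp, 0, (W.cell S x).indicator (fun _ => 1), Submodule.zero_mem _,
    W.indicator_cell_mem_poly hS x, ?_, ?_, ?_, ?_⟩
  · intro y hy; simp [hy]
  · intro y hy; simp [hy]
  · rw [integral_indicator (W.measurableSet_cell S x)]; simp
  · simp

/-- A large coefficient of `B` outside the current subgroup allows another step: the two-point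
identity `exp (t σ) = cosh t + σ sinh t` for `σ = ±1` supplies one more Riesz factor. -/
lemma RieszStep.succ [IsProbabilityMeasure μ] {S : Finset Γ} {x : X} {B : Set X} {ρ : ℝ} (hρ : 0 < ρ) {k : ℕ}
    {T : Finset Γ} (hT : W.RieszStep S x B ρ k T) {γ : Γ} (hγ : γ ∉ T)
    (hlarge : ρ * μ.real B ≤ |W.coeff B γ|) : ∃ T', W.RieszStep S x B ρ (k + 1) T' := by
  obtain ⟨hsub, hST, hcard, g, h, hg, hh, hexp, hzero, hint, hmean⟩ := hT
  obtain ⟨T', hT', hTT', hmul, hcard'⟩ := IsFinsetSubgroup.exists_insert W.mul_self hsub hγ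
  -- the sign making the contribution of `γ` on `B` positive
  obtain ⟨σ, hσ, hσc⟩ : ∃ σ : ℝ, (σ = 1 ∨ σ = -1) ∧ |W.coeff B γ| = σ * W.coeff B γ := by
    rcases abs_choice (W.coeff B γ) with h | h
    · exact ⟨1, Or.inl rfl, by rw [h, one_mul]⟩
    · exact ⟨-1, Or.inr rfl, by rw [h]; ring⟩
  have hγT' : γ ∈ T' := by simpa using hmul 1 hsub.one_mem
  have hfac : ∀ y, Real.exp (ρ * σ * W.char γ y)
      = Real.cosh ρ + σ * Real.sinh ρ * W.char γ y := by
    intro y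
    have hc := Real.cosh_add_sinh ρ
    have hs := Real.cosh_sub_sinh ρ
    rcases hσ with rfl | rfl <;> rcases W.char_eq_or γ y with h | h <;> rw [h] <;> ring_nf <;>
      linarith
  refine ⟨T', hT', hST.trans hTT', by rw [hcard', hcard]; ring,
    g + (ρ * σ) • W.char γ, Real.cosh ρ • h + (σ * Real.sinh ρ) • (h * W.char γ),
    Submodule.add_mem _ (W.poly_mono hTT' hg) (Submodule.smul_mem _ _ (W.char_mem_poly hγT')),
    Submodule.add_mem _ (Submodule.smul_mem _ _ (W.poly_mono hTT' hh))
      (Submodule.smul_mem _ _ (W.mul_char_mem_poly hmul hh)), ?_, ?_, ?_, ?_⟩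
  · intro y hy
    simp only [Pi.add_apply, Pi.smul_apply, Pi.mul_apply, smul_eq_mul, Real.exp_add, hfac,
      hexp y hy]
    ring
  · intro y hy
    simp [hzero y hy]
  · obtain ⟨hi, h0⟩ := W.integral_mul_char_eq_zero hγ hh
    simp only [Pi.add_apply, Pi.smul_apply, smul_eq_mul]
    rw [integral_add ((W.integrable_of_mem_poly hh).const_mul _) (hi.const_mul _),
      integral_const_mul, integral_const_mul, h0, mul_zero, add_zero]
    have h0 : 0 ≤ ∫ y, h y ∂μ := by
      refine integral_nonneg fun y => ?_
      by_cases hy : y ∈ W.cell S x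
      · rw [hexp y hy]; exact (Real.exp_pos _).le
      · rw [hzero y hy]; exact le_rfl
    calc Real.cosh ρ * ∫ y, h y ∂μ
        ≤ Real.exp (ρ ^ 2 / 2) * (Real.exp (k * ρ ^ 2 / 2) * μ.real (W.cell S x)) := by
          gcongr
          exact Real.cosh_le_exp_half_sq ρ
      _ = _ := by
          rw [← mul_assoc, ← Real.exp_add]
          congr 2
          push_cast
          ring
  · simp only [Pi.add_apply, Pi.smul_apply, smul_eq_mul]
    rw [integral_add (W.integrable_of_mem_poly hg).integrableOn
      ((W.integrable_char γ).integrableOn.const_mul _), integral_const_mul]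
    change _ ≤ _ + ρ * σ * W.coeff B γ
    have : ρ * (ρ * μ.real B) ≤ ρ * (σ * W.coeff B γ) := by
      rw [← hσc]; gcongr
    push_cast
    linarith

/-- Convexity of the exponential bounds the number of steps by the relative density of `B`. -/
lemma RieszStep.le_log [IsProbabilityMeasure μ] {S : Finset Γ} {x : X} {B : Set X} {ρ : ℝ} {k : ℕ}
    {T : Finset Γ} (hT : W.RieszStep S x B ρ k T) (hBm : MeasurableSet B)
    (hB : B ⊆ W.cell S x) (hpos : 0 < μ.real B) :
    k * ρ ^ 2 / 2 ≤ Real.log (μ.real (W.cell S x) / μ.real B) := by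
  obtain ⟨-, -, -, g, h, hg, hh, hexp, hzero, hint, hmean⟩ := hT
  set a : ℝ := k * ρ ^ 2 with ha
  have hcell : 0 < μ.real (W.cell S x) := hpos.trans_le (measureReal_mono hB)
  have hh0 : ∀ y, 0 ≤ h y := by
    intro y
    by_cases hy : y ∈ W.cell S x
    · rw [hexp y hy]; exact (Real.exp_pos _).le
    · rw [hzero y hy]
  have hhi := W.integrable_of_mem_poly hh
  have hgi := W.integrable_of_mem_poly hg
  have h1 : ∫ y in B, h y ∂μ ≤ ∫ y, h y ∂μ :=
    setIntegral_le_integral hhi (Filter.Eventually.of_forall hh0)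
  -- the tangent line of `exp` at `a`
  have h2 : ∫ y in B, (Real.exp a * (1 - a) + Real.exp a * g y) ∂μ ≤ ∫ y in B, h y ∂μ := by
    refine setIntegral_mono_on ?_ hhi.integrableOn hBm fun y hy => ?_
    · exact ((integrable_const _).add (hgi.const_mul _)).integrableOn
    · rw [hexp y (hB hy)]
      have := Real.add_one_le_exp (g y - a)
      have h3 : Real.exp (g y) = Real.exp a * Real.exp (g y - a) := by
        rw [← Real.exp_add]; congr 1; ring
      rw [h3]
      nlinarith [Real.exp_pos a]
  rw [integral_add (integrable_const _).integrableOn (hgi.const_mul _).integrableOn,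
    setIntegral_const, smul_eq_mul, integral_const_mul] at h2
  have h4 : Real.exp a * μ.real B ≤ Real.exp (a / 2) * μ.real (W.cell S x) := by
    have : Real.exp a * (a * μ.real B) ≤ Real.exp a * ∫ y in B, g y ∂μ := by gcongr
    nlinarith
  rw [Real.le_log_iff_exp_le (by positivity), le_div_iff₀ hpos]
  have h5 : Real.exp a = Real.exp (a / 2) * Real.exp (a / 2) := by
    rw [← Real.exp_add]; congr 1; ring
  rw [h5, mul_assoc] at h4
  exact le_of_mul_le_mul_left h4 (Real.exp_pos _)

/-- **Chang's theorem** relative to a cell: the large spectrum of a subset `B` of a cell of `S`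
lies in a subgroup containing `S` with index `2 ^ k`, where `k` is at most `2 ρ⁻²` times the
logarithm of the inverse relative density of `B`. -/
theorem exists_subgroup_of_large_coeff [IsProbabilityMeasure μ] {S : Finset Γ} (hS : IsFinsetSubgroup S) {x : X}
    {B : Set X} (hBm : MeasurableSet B) (hB : B ⊆ W.cell S x) (hpos : 0 < μ.real B) {ρ : ℝ}
    (hρ : 0 < ρ) :
    ∃ (T : Finset Γ) (k : ℕ), IsFinsetSubgroup T ∧ S ⊆ T ∧ T.card = S.card * 2 ^ k ∧
      (∀ γ, ρ * μ.real B ≤ |W.coeff B γ| → γ ∈ T) ∧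
      k * ρ ^ 2 / 2 ≤ Real.log (μ.real (W.cell S x) / μ.real B) := by
  by_contra hcon
  have key : ∀ k : ℕ, ∃ T, W.RieszStep S x B ρ k T := by
    intro k
    induction k with
    | zero => exact ⟨S, W.rieszStep_zero hS x B ρ⟩
    | succ k ih =>
      obtain ⟨T, hT⟩ := ih
      by_contra hno
      refine hcon ⟨T, k, hT.1, hT.2.1, hT.2.2.1, fun γ hγ => ?_, hT.le_log W hBm hB hpos⟩
      by_contra hmem
      exact hno (hT.succ W hρ hmem hγ)
  obtain ⟨k, hk⟩ := exists_nat_gt (Real.log (μ.real (W.cell S x) / μ.real B) / (ρ ^ 2 / 2))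
  obtain ⟨T, hT⟩ := key k
  have := hT.le_log W hBm hB hpos
  rw [div_lt_iff₀ (by positivity)] at hk
  linarith

end WalshSystem

/-! ### A dyadic pigeonhole -/

lemma sum_succ_mul_half_pow (K : ℕ) :
    ∑ j ∈ Finset.range K, ((j : ℝ) + 1) * (1 / 2) ^ j = 4 - (2 * K + 4) * (1 / 2) ^ K := by
  induction K with
  | zero => norm_num
  | succ K ih => rw [Finset.sum_range_succ, ih]; push_cast; ring

lemma le_sum_half_pow_add {w : ℝ} (hw : w ≤ 1) (K : ℕ) :
    w ≤ ∑ j ∈ Finset.range K, (if (1 / 2 : ℝ) ^ (j + 1) ≤ w then (1 / 2 : ℝ) ^ j else 0)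
      + (1 / 2) ^ K := by
  induction K with
  | zero => simpa using hw
  | succ K ih =>
    rw [Finset.sum_range_succ]
    split_ifs with h
    · have : (0 : ℝ) < (1 / 2) ^ (K + 1) := by positivity
      linarith
    · have : 0 ≤ ∑ j ∈ Finset.range K,
          (if (1 / 2 : ℝ) ^ (j + 1) ≤ w then (1 / 2 : ℝ) ^ j else 0) :=
        Finset.sum_nonneg fun j _ => by split_ifs <;> positivity
      linarith

/-- If a nonnegative summable family `a` has weighted sum at least `1 / 2` against weights
`w ≤ 1`, then at some dyadic level `2⁻ᵏ` the weights reaching that level carry `a`-mass at least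
`k / 16`: the mass gained grows with the cost of going to that level. -/
lemma exists_dyadic_level {ι : Type*} {a w : ι → ℝ} (ha : ∀ i, 0 ≤ a i) (hs : Summable a)
    (hw0 : ∀ i, 0 ≤ w i) (hw1 : ∀ i, w i ≤ 1) (hsum : 1 / 2 ≤ ∑' i, a i * w i) :
    ∃ k : ℕ, 1 ≤ k ∧ (k : ℝ) / 16 ≤ ∑' i, {i | (1 / 2 : ℝ) ^ k ≤ w i}.indicator a i := by
  by_contra! hcon
  obtain ⟨K, hK⟩ : ∃ K : ℕ, (1 / 2 : ℝ) ^ K * (∑' i, a i) < 1 / 4 := by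
    have h := (tendsto_pow_atTop_nhds_zero_of_lt_one (r := (1 / 2 : ℝ)) (by norm_num)
      (by norm_num)).mul_const (∑' i, a i)
    rw [zero_mul] at h
    exact (h.eventually_lt_const (by norm_num)).exists
  have hind : ∀ j : ℕ, Summable ({i | (1 / 2 : ℝ) ^ (j + 1) ≤ w i}.indicator a) :=
    fun j => hs.indicator _
  have hle : ∑' i, a i * w i ≤ ∑' i, (∑ j ∈ Finset.range K,
      (1 / 2 : ℝ) ^ j * {i | (1 / 2 : ℝ) ^ (j + 1) ≤ w i}.indicator a i
        + (1 / 2) ^ K * a i) := by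
    refine Summable.tsum_le_tsum (fun i => ?_) ?_ ?_
    · have := mul_le_mul_of_nonneg_left (le_sum_half_pow_add (hw1 i) K) (ha i)
      refine this.trans (le_of_eq ?_)
      rw [mul_add, Finset.mul_sum, mul_comm (a i) ((1 / 2) ^ K)]
      congr 1
      refine Finset.sum_congr rfl fun j _ => ?_
      simp only [Set.indicator_apply, Set.mem_ofPred_eq]
      split_ifs <;> ring
    · exact Summable.of_nonneg_of_le (fun i => mul_nonneg (ha i) (hw0 i))
        (fun i => mul_le_of_le_one_right (ha i) (hw1 i)) hs
    · exact (summable_sum fun j _ => (hind j).mul_left _).add (hs.mul_left _)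
  rw [Summable.tsum_add (summable_sum fun j _ => (hind j).mul_left _) (hs.mul_left _),
    Summable.tsum_finsetSum fun j _ => (hind j).mul_left _, tsum_mul_left] at hle
  have hlt : ∑ j ∈ Finset.range K,
      ∑' i, (1 / 2 : ℝ) ^ j * {i | (1 / 2 : ℝ) ^ (j + 1) ≤ w i}.indicator a i ≤ 1 / 4 := by
    calc _ ≤ ∑ j ∈ Finset.range K, (((j : ℝ) + 1) * (1 / 2) ^ j) / 16 := by
          refine Finset.sum_le_sum fun j _ => ?_
          rw [tsum_mul_left]
          have := (hcon (j + 1) (by omega)).le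
          push_cast at this
          calc _ ≤ (1 / 2 : ℝ) ^ j * (((j : ℝ) + 1) / 16) := by gcongr
            _ = _ := by ring
      _ ≤ 1 / 4 := by
          rw [← Finset.sum_div, sum_succ_mul_half_pow]
          have : (0 : ℝ) ≤ (2 * K + 4) * (1 / 2) ^ K := by positivity
          linarith
  linarith

namespace WalshSystem

variable {X : Type*} [MeasurableSpace X] {μ : Measure X} [IsProbabilityMeasure μ]
  {Γ : Type*} [CommGroup Γ] (W : WalshSystem μ Γ)

/-! ### A balanced cell -/

/-- If every cell of `S` were almost full or almost empty of `A`, then the measure of `A` would be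
close to an integer multiple of the common measure of the cells. -/
lemma exists_int_near {S : Finset Γ} (hS : IsFinsetSubgroup S) {A : Set X} (hA : MeasurableSet A)
    (h : ∀ x, ∃ n : ℤ, |S.card * μ.real (A ∩ W.cell S x) - n| ≤ 1 / (4 * S.card)) :
    ∃ N : ℤ, |S.card * μ.real A - N| ≤ 1 / 4 := by
  classical
  -- the sign pattern of a point; its fibres are the cells
  let p : X → (S → Bool) := fun x s => decide (W.char s x = 1)
  have hp : Measurable p := by
    refine measurable_pi_lambda _ fun s => ?_
    refine measurable_to_bool ?_
    have : (fun x => p x s) ⁻¹' {true} = {x | W.char s x = 1} := by ext x; simp [p]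
    rw [this]
    exact measurableSet_eq_fun (W.measurable_char s) measurable_const
  have hfib : ∀ x, p ⁻¹' {p x} = W.cell S x := by
    intro x
    ext y
    simp only [Set.mem_preimage, Set.mem_singleton_iff, funext_iff, p, cell, Set.mem_ofPred_eq,
      Subtype.forall, decide_eq_decide]
    refine forall₂_congr fun s _ => ?_
    rcases W.char_eq_or s x with hx | hx <;> rcases W.char_eq_or s y with hy | hy <;>
      rw [hx, hy] <;> norm_num
  have hsum : ∀ B : Set X, MeasurableSet B → μ.real B = ∑ v, μ.real (B ∩ p ⁻¹' {v}) := by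
    intro B hB
    rw [← measureReal_biUnion_finset]
    · congr 1
      ext y
      simp
    · intro u _ v _ huv
      refine Set.disjoint_left.mpr fun y hy hy' => huv ?_
      exact hy.2.symm.trans hy'.2
    · exact fun v _ => hB.inter (hp (measurableSet_singleton v))
  have hcell : ∀ v, ∃ n : ℤ,
      |S.card * μ.real (A ∩ p ⁻¹' {v}) - n| ≤ 1 / 4 * μ.real (Set.univ ∩ p ⁻¹' {v}) := by
    intro v
    by_cases hv : ∃ x, p x = v
    · obtain ⟨x, rfl⟩ := hv
      obtain ⟨n, hn⟩ := h x
      refine ⟨n, ?_⟩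
      rw [hfib, Set.univ_inter]
      refine hn.trans (le_of_eq ?_)
      have h1 := W.card_mul_measure_cell hS x
      have hc : (S.card : ℝ) ≠ 0 := left_ne_zero_of_mul_eq_one h1
      field_simp
      linarith
    · refine ⟨0, ?_⟩
      have : p ⁻¹' {v} = ∅ := by
        ext y
        simpa using fun hy => hv ⟨y, hy⟩
      rw [this]
      simp
  choose n hn using hcell
  refine ⟨∑ v, n v, ?_⟩
  rw [hsum A hA, Finset.mul_sum, Int.cast_sum, ← Finset.sum_sub_distrib]
  refine (Finset.abs_sum_le_sum_abs _ _).trans ((Finset.sum_le_sum fun v _ => hn v).trans ?_)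
  rw [← Finset.mul_sum, ← hsum _ MeasurableSet.univ]
  simp

/-- A set of density near `1 / 3` is balanced on some cell, because `1 / 3` is far from the
multiples of `2⁻ᵈ`. -/
lemma exists_balanced_cell {S : Finset Γ} (hS : IsFinsetSubgroup S) {d : ℕ} (hd : S.card = 2 ^ d)
    {A : Set X} (hA : MeasurableSet A) {ε : ℝ} (hε : |μ.real A - 1 / 3| ≤ ε)
    (hsmall : 12 * ε * 2 ^ d < 1) :
    ∃ x, 1 / (4 * 2 ^ d) ≤ 2 ^ d * μ.real (A ∩ W.cell S x) ∧
      2 ^ d * μ.real (A ∩ W.cell S x) ≤ 1 - 1 / (4 * 2 ^ d) := by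
  have hcard : (S.card : ℝ) = 2 ^ d := by rw [hd]; push_cast; rfl
  by_contra! hcon
  obtain ⟨N, hN⟩ := W.exists_int_near hS hA fun x => by
    rw [hcard]
    have hb0 : 0 ≤ 2 ^ d * μ.real (A ∩ W.cell S x) := by positivity
    have hb1 : 2 ^ d * μ.real (A ∩ W.cell S x) ≤ 1 := by
      rw [← W.card_mul_measure_cell hS x, hcard]
      gcongr
      · exact measure_ne_top _ _
      · exact Set.inter_subset_right
    by_cases hlow : 1 / (4 * 2 ^ d) ≤ 2 ^ d * μ.real (A ∩ W.cell S x)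
    · refine ⟨1, ?_⟩
      have := hcon x hlow
      rw [abs_le]
      push_cast
      constructor
      · linarith
      · have : (0 : ℝ) ≤ 1 / (4 * 2 ^ d) := by positivity
        linarith
    · refine ⟨0, ?_⟩
      push Not at hlow
      rw [Int.cast_zero, sub_zero, abs_of_nonneg hb0]
      exact hlow.le
  rw [hcard] at hN
  have h3 : (1 : ℤ) ≤ |2 ^ d - 3 * N| := by
    refine Int.one_le_abs fun h0 => ?_
    have hdvd : (3 : ℤ) ∣ 2 ^ d := ⟨N, by linarith⟩
    have := Int.prime_three.dvd_of_dvd_pow hdvd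
    omega
  have h3' : (1 : ℝ) ≤ |(2 : ℝ) ^ d - 3 * (N : ℝ)| := by exact_mod_cast h3
  have h4 : |(2 : ℝ) ^ d * (μ.real A - 1 / 3)| ≤ 2 ^ d * ε := by
    rw [abs_mul, abs_of_pos (by positivity)]
    gcongr
  rw [abs_le] at hN h4
  rcases le_abs.mp h3' with h | h <;> linarith

/-! ### The increment -/

/-- The mass carried by `S` in the Fourier algebra norm of the indicator function of `A`. -/
noncomputable def mass (A : Set X) (S : Finset Γ) : ℝ := ∑ γ ∈ S, |W.coeff A γ|

/-- A subset `B` of a cell correlates with the part of the indicator of `A` whose spectrum lies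
outside `S`, as soon as the mean of the indicator over `B` differs by at least `1 / 2` from its mean
over the cell. -/
lemma half_le_tsum_compl {S : Finset Γ} (hS : IsFinsetSubgroup S) {A B : Set X}
    (hA : MeasurableSet A) (hBm : MeasurableSet B) {x : X} (hB : B ⊆ W.cell S x)
    (hpos : 0 < μ.real B) (hsum : Summable fun γ => |W.coeff A γ|)
    (hhalf : μ.real B / 2 ≤ |μ.real (A ∩ B) - S.card * μ.real (A ∩ W.cell S x) * μ.real B|) :
    1 / 2 ≤ ∑' γ, ((S : Set Γ)ᶜ.indicator (fun γ => |W.coeff A γ|) γ)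
      * (|W.coeff B γ| / μ.real B) := by
  classical
  have hP : HasSum (fun γ => W.coeff A γ * W.coeff B γ) (μ.real (A ∩ B)) :=
    W.hasSum_setIntegral_mul A B hA hBm
  have hfin : ∑ γ ∈ S, W.coeff A γ * W.coeff B γ
      = S.card * μ.real (A ∩ W.cell S x) * μ.real B := by
    rw [← W.sum_char_mul_coeff hS, Finset.sum_mul]
    refine Finset.sum_congr rfl fun s hs => ?_
    rw [W.coeff_of_subset_cell hBm hB hs]
    ring
  have hcompl : HasSum ((S : Set Γ)ᶜ.indicator fun γ => W.coeff A γ * W.coeff B γ)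
      (μ.real (A ∩ B) - S.card * μ.real (A ∩ W.cell S x) * μ.real B) := by
    have h1 : HasSum ((S : Set Γ).indicator fun γ => W.coeff A γ * W.coeff B γ)
        (∑ γ ∈ S, (S : Set Γ).indicator (fun γ => W.coeff A γ * W.coeff B γ) γ) :=
      hasSum_sum_of_ne_finset_zero fun b hb => by simp [hb]
    rw [Finset.sum_congr rfl (g := fun γ => W.coeff A γ * W.coeff B γ)
      (fun γ hγ => by simp [hγ]), hfin] at h1
    have h2 : ((S : Set Γ)ᶜ.indicator fun γ => W.coeff A γ * W.coeff B γ)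
        = fun γ => W.coeff A γ * W.coeff B γ
          - (S : Set Γ).indicator (fun γ => W.coeff A γ * W.coeff B γ) γ := by
      funext γ
      by_cases h : γ ∈ S <;> simp [h]
    rw [h2]
    exact hP.sub h1
  have hs : Summable fun γ => ((S : Set Γ)ᶜ.indicator (fun γ => |W.coeff A γ|) γ)
      * (|W.coeff B γ| / μ.real B) := by
    refine Summable.of_nonneg_of_le (fun γ => ?_) (fun γ => ?_) hsum
    · refine mul_nonneg (Set.indicator_nonneg (fun _ _ => abs_nonneg _) _) (by positivity)
    · refine (mul_le_of_le_one_right (Set.indicator_nonneg (fun _ _ => abs_nonneg _) _) ?_).trans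
        (Set.indicator_le_self' (fun _ _ => abs_nonneg _) _)
      exact (div_le_one hpos).mpr (W.abs_coeff_le B γ)
  have hb : |μ.real (A ∩ B) - S.card * μ.real (A ∩ W.cell S x) * μ.real B|
      ≤ μ.real B * ∑' γ, ((S : Set Γ)ᶜ.indicator (fun γ => |W.coeff A γ|) γ)
        * (|W.coeff B γ| / μ.real B) := by
    rw [← tsum_mul_left, ← hcompl.tsum_eq, ← Real.norm_eq_abs]
    refine tsum_of_norm_bounded (hs.mul_left _).hasSum fun γ => ?_
    by_cases h : γ ∈ S
    · simp [h]
    · simp only [Set.indicator_apply, Set.mem_compl_iff, Finset.mem_coe, h, not_false_eq_true,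
        if_true, Real.norm_eq_abs, abs_mul]
      refine le_of_eq ?_
      field_simp
  have := hhalf.trans hb
  rw [div_eq_mul_one_div] at this
  exact le_of_mul_le_mul_left this hpos

/-- One step of the iteration: the logarithm of the dimension grows by at most a constant times
the mass gained. -/
lemma exists_increment {S : Finset Γ} (hS : IsFinsetSubgroup S) {d : ℕ} (hd : S.card = 2 ^ d)
    {A : Set X} (hA : MeasurableSet A) (hsum : Summable fun γ => |W.coeff A γ|)
    {ε : ℝ} (hε : |μ.real A - 1 / 3| ≤ ε) (hsmall : 12 * ε * 2 ^ d < 1) :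
    ∃ (T : Finset Γ) (e k : ℕ), IsFinsetSubgroup T ∧ T.card = 2 ^ e ∧ 1 ≤ k ∧
      (e + 2 : ℝ) ≤ (d + 2) * 16 ^ k ∧ W.mass A S + k / 16 ≤ W.mass A T := by
  classical
  obtain ⟨x, hx0, hx1⟩ := W.exists_balanced_cell hS hd hA hε hsmall
  have hcard : (S.card : ℝ) = 2 ^ d := by rw [hd]; push_cast; rfl
  have h2d : (0 : ℝ) < 2 ^ d := by positivity
  have hcellm := W.measurableSet_cell S x
  have hcell : 2 ^ d * μ.real (W.cell S x) = 1 := hcard ▸ W.card_mul_measure_cell hS x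
  -- `B` is the minority part of the balanced cell
  obtain ⟨B, hBm, hB, hBlow, hhalf⟩ : ∃ B, MeasurableSet B ∧ B ⊆ W.cell S x ∧
      1 / (4 * 2 ^ d) ≤ 2 ^ d * μ.real B ∧
      μ.real B / 2 ≤ |μ.real (A ∩ B) - S.card * μ.real (A ∩ W.cell S x) * μ.real B| := by
    rw [hcard]
    by_cases hb : 2 ^ d * μ.real (A ∩ W.cell S x) ≤ 1 / 2
    · refine ⟨A ∩ W.cell S x, hA.inter hcellm, Set.inter_subset_right, hx0, ?_⟩
      rw [← Set.inter_assoc, Set.inter_self]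
      refine le_trans ?_ (le_abs_self _)
      have : (0 : ℝ) ≤ μ.real (A ∩ W.cell S x) := measureReal_nonneg
      nlinarith
    · refine ⟨W.cell S x \ A, hcellm.diff hA, Set.sdiff_subset, ?_, ?_⟩
      · have := measureReal_inter_add_sdiff (μ := μ) (s := W.cell S x) hA
        rw [Set.inter_comm] at this
        nlinarith
      · push Not at hb
        rw [Set.inter_sdiff_self, measureReal_empty, zero_sub, abs_neg]
        refine le_trans ?_ (le_abs_self _)
        have : (0 : ℝ) ≤ μ.real (W.cell S x \ A) := measureReal_nonneg
        nlinarith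
  have hpos : 0 < μ.real B := by
    have : (0 : ℝ) < 1 / (4 * 2 ^ d) := by positivity
    exact pos_of_mul_pos_right (this.trans_le hBlow) h2d.le
  have hs' : Summable ((S : Set Γ)ᶜ.indicator fun γ => |W.coeff A γ|) := hsum.indicator _
  obtain ⟨k, hk1, hk⟩ := exists_dyadic_level (fun γ => Set.indicator_nonneg
    (fun _ _ => abs_nonneg _) γ) hs' (w := fun γ => |W.coeff B γ| / μ.real B)
    (fun γ => by positivity) (fun γ => (div_le_one hpos).mpr (W.abs_coeff_le B γ))
    (W.half_le_tsum_compl hS hA hBm hB hpos hsum hhalf)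
  obtain ⟨T, m, hT, hST, hTcard, hlarge, hm⟩ :=
    W.exists_subgroup_of_large_coeff hS hBm hB hpos (ρ := (1 / 2) ^ k) (by positivity)
  refine ⟨T, d + m, k, hT, by rw [hTcard, hd, pow_add], hk1, ?_, ?_⟩
  · have hlog : Real.log (μ.real (W.cell S x) / μ.real B) ≤ d + 2 := by
      have hratio : μ.real (W.cell S x) / μ.real B ≤ 2 ^ (d + 2) := by
        rw [div_le_iff₀ hpos]
        have h1 : (1 : ℝ) ≤ 2 ^ d * μ.real B * (4 * 2 ^ d) := by
          rwa [div_le_iff₀ (by positivity)] at hBlow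
        have h2 : 2 ^ d * μ.real (W.cell S x) ≤ 2 ^ d * (2 ^ (d + 2) * μ.real B) := by
          rw [hcell, pow_add]; linarith
        exact le_of_mul_le_mul_left h2 h2d
      have hl2 : Real.log 2 ≤ 1 := by linarith [Real.log_two_lt_d9]
      calc _ ≤ Real.log (2 ^ (d + 2)) := by
            refine Real.log_le_log (div_pos ?_ hpos) hratio
            exact hpos.trans_le (measureReal_mono hB)
        _ = (d + 2) * Real.log 2 := by rw [Real.log_pow]; push_cast; ring
        _ ≤ (d + 2) * 1 := by gcongr
        _ = d + 2 := mul_one _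
    have h1 := hm.trans hlog
    have h4 : (4 : ℝ) ≤ 4 ^ k := by
      calc (4 : ℝ) = 4 ^ 1 := by norm_num
        _ ≤ 4 ^ k := pow_le_pow_right₀ (by norm_num) hk1
    have h5 : ((1 / 2 : ℝ) ^ k) ^ 2 * 4 ^ k = 1 := by
      rw [← pow_mul, mul_comm k 2, pow_mul, ← mul_pow]; norm_num
    have h6 : (m : ℝ) ≤ 2 * 4 ^ k * (d + 2) := by
      calc (m : ℝ) = m * (((1 / 2 : ℝ) ^ k) ^ 2 * 4 ^ k) := by rw [h5, mul_one]
        _ = m * ((1 / 2 : ℝ) ^ k) ^ 2 / 2 * (2 * 4 ^ k) := by ring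
        _ ≤ (d + 2) * (2 * 4 ^ k) := by gcongr
        _ = _ := by ring
    have h7 : (16 : ℝ) ^ k = 4 ^ k * 4 ^ k := by rw [← mul_pow]; norm_num
    have hd0 : (0 : ℝ) ≤ d := Nat.cast_nonneg d
    push_cast
    rw [h7]
    have : (1 + 2 * (4 : ℝ) ^ k) ≤ 4 ^ k * 4 ^ k := by nlinarith
    nlinarith
  · have hle : ∑' γ, {γ | (1 / 2 : ℝ) ^ k ≤ |W.coeff B γ| / μ.real B}.indicator
        ((S : Set Γ)ᶜ.indicator fun γ => |W.coeff A γ|) γ ≤ ∑ γ ∈ T \ S, |W.coeff A γ| := by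
      rw [tsum_eq_sum (s := T \ S)]
      · refine Finset.sum_le_sum fun γ _ => ?_
        refine (Set.indicator_le_self' (fun _ _ => Set.indicator_nonneg
          (fun _ _ => abs_nonneg _) _) _).trans (Set.indicator_le_self' (fun _ _ => abs_nonneg _) _)
      · intro γ hγ
        simp only [Set.indicator_apply, Set.mem_ofPred_eq]
        split_ifs with h1 h2
        · exact absurd (Finset.mem_sdiff.mpr ⟨hlarge γ ((le_div_iff₀ hpos).mp h1), h2⟩) hγ
        · rfl
        · rfl
    have := Finset.sum_sdiff (f := fun γ => |W.coeff A γ|) hST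
    simp only [mass]
    linarith

/-! ### The iteration -/

/-- The Fourier algebra norm of the indicator function of a set of positive measure is at
least one. -/
lemma one_le_tsum_abs_coeff {A : Set X} (hA : MeasurableSet A) (hpos : 0 < μ.real A)
    (hsum : Summable fun γ => |W.coeff A γ|) : 1 ≤ ∑' γ, |W.coeff A γ| := by
  have hP : HasSum (fun γ => W.coeff A γ * W.coeff A γ) (μ.real (A ∩ A)) :=
    W.hasSum_setIntegral_mul A A hA hA
  rw [Set.inter_self] at hP
  have : μ.real A ≤ μ.real A * ∑' γ, |W.coeff A γ| := by
    rw [← tsum_mul_left]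
    conv_lhs => rw [← hP.tsum_eq]
    refine Summable.tsum_le_tsum (fun γ => ?_) hP.summable (hsum.mul_left _)
    rw [← abs_mul_abs_self]
    gcongr
    exact W.abs_coeff_le A γ
  nlinarith

/-- The iteration stops at a subgroup of order `2 ^ d` that is too large to distinguish the
density of `A` from `1 / 3`, while `log (d + 2)` is controlled by the mass. -/
lemma exists_large_subgroup {A : Set X} (hA : MeasurableSet A)
    (hsum : Summable fun γ => |W.coeff A γ|) {ε : ℝ} (hε : |μ.real A - 1 / 3| ≤ ε) :
    ∃ d : ℕ, 1 ≤ 12 * ε * 2 ^ d ∧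
      Real.log (d + 2) ≤ Real.log 2 + 16 * Real.log 16 * ∑' γ, |W.coeff A γ| := by
  have hmass : ∀ S : Finset Γ, W.mass A S ≤ ∑' γ, |W.coeff A γ| := fun S =>
    hsum.sum_le_tsum S fun _ _ => abs_nonneg _
  by_contra! hcon
  have key : ∀ n : ℕ, ∃ (S : Finset Γ) (d : ℕ), IsFinsetSubgroup S ∧ S.card = 2 ^ d ∧
      Real.log (d + 2) ≤ Real.log 2 + 16 * Real.log 16 * W.mass A S ∧
      (n : ℝ) / 16 ≤ W.mass A S := by
    intro n
    induction n with
    | zero =>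
      have h0 : 0 ≤ W.mass A {1} := Finset.sum_nonneg fun _ _ => abs_nonneg _
      refine ⟨{1}, 0, ⟨by simp, by simp⟩, by simp, ?_, by simpa using h0⟩
      rw [Nat.cast_zero, zero_add]
      have : 0 ≤ Real.log 16 := Real.log_nonneg (by norm_num)
      have := mul_nonneg this h0
      linarith
    | succ n ih =>
      obtain ⟨S, d, hS, hd, hlog, hn⟩ := ih
      have hsmall : 12 * ε * 2 ^ d < 1 := by
        by_contra hbig
        have h1 := hcon d (not_lt.mp hbig)
        have h2 : 16 * Real.log 16 * W.mass A S ≤ 16 * Real.log 16 * ∑' γ, |W.coeff A γ| := by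
          have : 0 ≤ Real.log 16 := Real.log_nonneg (by norm_num)
          gcongr
          exact hmass S
        linarith
      obtain ⟨T, e, k, hT, he, hk1, hek, hgain⟩ :=
        W.exists_increment hS hd hA hsum hε hsmall
      have hk1' : (1 : ℝ) ≤ k := by exact_mod_cast hk1
      refine ⟨T, e, hT, he, ?_, by push_cast; linarith⟩
      have h3 : Real.log (e + 2) ≤ Real.log (d + 2) + k * Real.log 16 := by
        rw [← Real.log_pow, ← Real.log_mul (by positivity) (by positivity)]
        exact Real.log_le_log (by positivity) hek
      have h4 : 0 < Real.log 16 := Real.log_pos (by norm_num)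
      nlinarith
  obtain ⟨n, hn⟩ := exists_nat_gt (16 * ∑' γ, |W.coeff A γ|)
  obtain ⟨S, d, -, -, -, h⟩ := key n
  have := hmass S
  linarith

/-- The lower bound for the Fourier algebra norm of a set of density near `1 / 3`, for a general
Walsh system. -/
theorem log_log_le_tsum {A : Set X} (hA : MeasurableSet A)
    (hsum : Summable fun γ => |W.coeff A γ|) {ε : ℝ} (hε0 : 0 < ε) (hε1 : ε < 1 / 3)
    (hε : |μ.real A - 1 / 3| ≤ ε) :
    1 / (66 * Real.log 2) * Real.log (Real.log ε⁻¹) ≤ ∑' γ, |W.coeff A γ| := by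
  obtain ⟨d, hd, hlog⟩ := W.exists_large_subgroup hA hsum hε
  have hl2 : 0 < Real.log 2 := Real.log_pos (by norm_num)
  have hl2' : Real.log 2 ≤ 1 := by linarith [Real.log_two_lt_d9]
  have hM : 1 ≤ ∑' γ, |W.coeff A γ| := by
    refine W.one_le_tsum_abs_coeff hA ?_ hsum
    rw [abs_le] at hε
    linarith
  have h1 : Real.log ε⁻¹ ≤ 2 * (d + 2) := by
    have h2 : ε⁻¹ ≤ 2 ^ (d + 4) := by
      rw [inv_le_iff_one_le_mul₀' hε0, pow_add]
      have : 0 < ε * 2 ^ d := by positivity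
      linarith
    calc Real.log ε⁻¹ ≤ Real.log (2 ^ (d + 4)) := Real.log_le_log (by positivity) h2
      _ = (d + 4) * Real.log 2 := by rw [Real.log_pow]; push_cast; ring
      _ ≤ (d + 4) * 1 := by gcongr
      _ ≤ 2 * (d + 2) := by linarith [(Nat.cast_nonneg d : (0 : ℝ) ≤ d)]
  have h3 : 0 < Real.log ε⁻¹ := by
    refine Real.log_pos ?_
    rw [one_lt_inv₀ hε0]
    linarith
  have h4 : Real.log (Real.log ε⁻¹) ≤ Real.log 2 + Real.log (d + 2) := by
    rw [← Real.log_mul (by norm_num) (by positivity)]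
    exact Real.log_le_log h3 h1
  have h16 : Real.log 16 = 4 * Real.log 2 := by
    rw [show (16 : ℝ) = 2 ^ 4 by norm_num, Real.log_pow]; norm_num
  rw [h16] at hlog
  rw [one_div, inv_mul_le_iff₀ (by positivity)]
  nlinarith

end WalshSystem

/-! ### Commuting involutions -/

/-- A family of commuting involutions preserving a nonzero finite-dimensional subspace has a common
eigenvector there, with eigenvalues `±1`. -/
lemma exists_common_eigenvector {ι V : Type*} [AddCommGroup V] [Module ℝ V] (S : ι → V →ₗ[ℝ] V)
    (hinv : ∀ i v, S i (S i v) = v) (hcomm : ∀ i j v, S i (S j v) = S j (S i v))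
    (n : ℕ) (E : Submodule ℝ V) [FiniteDimensional ℝ E] (hn : Module.finrank ℝ E ≤ n)
    (hE : E ≠ ⊥) (hSE : ∀ i, ∀ v ∈ E, S i v ∈ E) :
    ∃ v ∈ E, v ≠ 0 ∧ ∀ i, S i v = v ∨ S i v = -v := by
  induction n generalizing E with
  | zero =>
    exact absurd (Submodule.finrank_eq_zero.mp (Nat.le_zero.mp hn)) hE
  | succ n ih =>
    by_cases hscalar : ∀ i, (∀ v ∈ E, S i v = v) ∨ (∀ v ∈ E, S i v = -v)
    · obtain ⟨v, hv, hv0⟩ := Submodule.exists_mem_ne_zero_of_ne_bot hE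
      exact ⟨v, hv, hv0, fun i => (hscalar i).imp (fun h => h v hv) (fun h => h v hv)⟩
    · push Not at hscalar
      obtain ⟨i, ⟨a, haE, ha⟩, b, hbE, hb⟩ := hscalar
      -- the fixed space of `S i` in `E` is nonzero, proper and invariant
      let F : Submodule ℝ V := E ⊓ LinearMap.ker (S i - LinearMap.id)
      have hF : ∀ v, v ∈ F ↔ v ∈ E ∧ S i v = v := by
        intro v; simp [F, sub_eq_zero]
      have hFE : F ≤ E := inf_le_left
      have hlt : F < E := by
        refine lt_of_le_of_ne hFE fun h => ha ?_
        exact ((hF a).mp (h ▸ haE)).2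
      have : FiniteDimensional ℝ F := Submodule.finiteDimensional_of_le hFE
      obtain ⟨v, hv, hv0, hv1⟩ := ih F
        (by have := Submodule.finrank_lt_finrank_of_lt hlt; omega)
        (by
          intro h0
          have hmem : b + S i b ∈ F := by
            rw [hF, map_add, hinv, add_comm]
            exact ⟨E.add_mem (hSE i b hbE) hbE, rfl⟩
          rw [h0, Submodule.mem_bot] at hmem
          exact hb (eq_neg_of_add_eq_zero_right hmem))
        (by
          intro j v hv
          rw [hF] at hv ⊢
          exact ⟨hSE j v hv.1, by rw [hcomm, hv.2]⟩)
      exact ⟨v, hFE hv, hv0, hv1⟩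

/-! ### Integral operators with kernel `u (x + y)` -/

namespace SumKernel

variable {G : Type*} [AddCommGroup G] [TopologicalSpace G] [IsTopologicalAddGroup G]
  [CompactSpace G] [MeasurableSpace G] [BorelSpace G]

/-- The translates of `u`, as a continuous family of continuous functions. -/
def translates (u : C(G, ℝ)) : C(G, C(G, ℝ)) :=
  (u.comp ⟨fun p : G × G => p.1 + p.2, continuous_add⟩).curry

variable (μ : Measure G) [IsFiniteMeasure μ]

/-- The translates of `u`, as a continuous family of elements of `L²`. -/
noncomputable def kernel (u : C(G, ℝ)) : C(G, Lp ℝ 2 μ) :=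
  ⟨fun x => ContinuousMap.toLp 2 μ ℝ (translates u x), by fun_prop⟩

/-- The integral operator `f ↦ (x ↦ ∫ u (x + y) f y)` from `L²` to continuous functions. -/
noncomputable def toCont (u : C(G, ℝ)) : Lp ℝ 2 μ →L[ℝ] C(G, ℝ) :=
  LinearMap.mkContinuous
    { toFun := fun f => ⟨fun x => inner ℝ (kernel μ u x) f, by fun_prop⟩
      map_add' := fun f g => by ext x; simp [inner_add_right]
      map_smul' := fun c f => by ext x; simp [inner_smul_right] }
    ‖kernel μ u‖ (fun f => by
      rw [ContinuousMap.norm_le _ (by positivity)]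
      intro x
      refine (norm_inner_le_norm (𝕜 := ℝ) (kernel μ u x) f).trans ?_
      gcongr
      exact (kernel μ u).norm_coe_le_norm x)

lemma toCont_apply (u : C(G, ℝ)) (f : Lp ℝ 2 μ) (x : G) :
    toCont μ u f x = inner ℝ (kernel μ u x) f := rfl

lemma toCont_toLp (u v : C(G, ℝ)) (x : G) :
    toCont μ u (ContinuousMap.toLp 2 μ ℝ v) x = ∫ y, u (x + y) * v y ∂μ := by
  rw [toCont_apply]
  change inner ℝ (ContinuousMap.toLp 2 μ ℝ (translates u x)) _ = _
  rw [ContinuousMap.inner_toLp]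
  refine integral_congr_ae (Filter.Eventually.of_forall fun y => ?_)
  simp [translates, mul_comm]

/-- The integral operator as an operator on `L²`. -/
noncomputable def op (u : C(G, ℝ)) : Lp ℝ 2 μ →L[ℝ] Lp ℝ 2 μ :=
  (ContinuousMap.toLp 2 μ ℝ).comp (toCont μ u)

/-- Compactness of the integral operator, by the Arzelà–Ascoli theorem. -/
lemma isCompactOperator_toCont (u : C(G, ℝ)) : IsCompactOperator (toCont μ u) := by
  let Q : Set (G → ℝ) := {h | (∀ x, h x ∈ Set.Icc (-‖kernel μ u‖) ‖kernel μ u‖) ∧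
    ∀ x y, |h x - h y| ≤ ‖kernel μ u x - kernel μ u y‖}
  have hQ : IsCompact Q := by
    have h1 : IsCompact (Set.univ.pi fun _ : G => Set.Icc (-‖kernel μ u‖) ‖kernel μ u‖) :=
      isCompact_univ_pi fun _ => isCompact_Icc
    refine h1.of_isClosed_subset ?_ fun h hh x _ => hh.1 x
    have : Q = (⋂ x, {h : G → ℝ | h x ∈ Set.Icc (-‖kernel μ u‖) ‖kernel μ u‖}) ∩
        ⋂ x, ⋂ y, {h : G → ℝ | |h x - h y| ≤ ‖kernel μ u x - kernel μ u y‖} := by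
      ext h; simp [Q]
    rw [this]
    refine (isClosed_iInter fun x => isClosed_Icc.preimage (continuous_apply x)).inter
      (isClosed_iInter fun x => isClosed_iInter fun y => ?_)
    exact isClosed_le (by fun_prop) continuous_const
  let P : Set C(G, ℝ) := {h | (h : G → ℝ) ∈ Q}
  have hequi : ∀ x₀ : G, ∀ ε > 0, ∀ᶠ x in nhds x₀, ‖kernel μ u x₀ - kernel μ u x‖ < ε := by
    intro x₀ ε hε
    have : Continuous fun x => ‖kernel μ u x₀ - kernel μ u x‖ := by fun_prop
    exact (this.tendsto' x₀ 0 (by simp)).eventually_lt_const hε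
  have himage : ContinuousMap.toFun '' P = Q := by
    ext h
    constructor
    · rintro ⟨g, hg, rfl⟩; exact hg
    · intro hh
      refine ⟨⟨h, ?_⟩, hh, rfl⟩
      rw [continuous_iff_continuousAt]
      intro x₀
      rw [ContinuousAt, Metric.tendsto_nhds]
      intro ε hε
      filter_upwards [hequi x₀ ε hε] with x hx
      rw [dist_comm, Real.dist_eq]
      exact (hh.2 x₀ x).trans_lt hx
  have hP : IsCompact P := by
    refine ArzelaAscoli.isCompact_of_equicontinuous P (himage ▸ hQ) fun x₀ => ?_
    rw [Metric.equicontinuousAt_iff_right]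
    intro ε hε
    filter_upwards [hequi x₀ ε hε] with x hx g
    rw [Real.dist_eq]
    exact (g.2.2 x₀ x).trans_lt hx
  rw [← ContinuousLinearMap.coe_coe,
    isCompactOperator_iff_image_closedBall_subset_compact _ one_pos]
  refine ⟨P, hP, ?_⟩
  rintro _ ⟨f, hf, rfl⟩
  rw [mem_closedBall_zero_iff] at hf
  have hb : ∀ w : Lp ℝ 2 μ, |inner ℝ w f| ≤ ‖w‖ := fun w =>
    (abs_real_inner_le_norm w f).trans (mul_le_of_le_one_right (norm_nonneg _) hf)
  refine ⟨fun x => ?_, fun x y => ?_⟩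
  · exact abs_le.mp ((hb _).trans ((kernel μ u).norm_coe_le_norm x))
  · change |inner ℝ (kernel μ u x) f - inner ℝ (kernel μ u y) f| ≤ _
    rw [← inner_sub_left]
    exact hb _

lemma isCompactOperator_op (u : C(G, ℝ)) : IsCompactOperator (op μ u) :=
  (isCompactOperator_toCont μ u).clm_comp (ContinuousMap.toLp 2 μ ℝ)

variable [T2Space G] [μ.WeaklyRegular]

lemma isSymmetric_op (u : C(G, ℝ)) : (op μ u : Lp ℝ 2 μ →ₗ[ℝ] Lp ℝ 2 μ).IsSymmetric := by
  have hd : DenseRange (ContinuousMap.toLp 2 μ ℝ : C(G, ℝ) → Lp ℝ 2 μ) :=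
    ContinuousMap.toLp_denseRange ℝ μ ℝ (by norm_num)
  intro f g
  refine hd.induction_on₂ (p := fun f g => inner ℝ (op μ u f) g = inner ℝ f (op μ u g))
    (isClosed_eq (by fun_prop) (by fun_prop)) (fun a b => ?_) f g
  simp only [op, ContinuousLinearMap.comp_apply]
  rw [ContinuousMap.inner_toLp, ContinuousMap.inner_toLp]
  simp only [toCont_toLp, conj_trivial]
  simp_rw [← integral_const_mul, ← integral_mul_const]
  rw [integral_integral_swap_of_hasCompactSupport]
  · refine integral_congr_ae (Filter.Eventually.of_forall fun y => ?_)
    refine integral_congr_ae (Filter.Eventually.of_forall fun x => ?_)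
    simp only [add_comm x y]
    ring
  · simp only [Function.uncurry_def]; fun_prop
  · exact HasCompactSupport.of_compactSpace _

end SumKernel

/-! ### Characters of a compact group of exponent two -/

namespace CompactF2

section Characters

variable {G : Type*} [AddCommGroup G] [TopologicalSpace G]

/-- The character of `G` given by a continuous real function `v` with `v (x + g) = ± v x`. -/
lemma exists_dual_of_translate_eq_or (v : C(G, ℝ)) (hv : v ≠ 0)
    (h : ∀ g, (∀ x, v (x + g) = v x) ∨ ∀ x, v (x + g) = -v x) :
    ∃ γ : Dual G, ∀ g, (γ (Multiplicative.ofAdd g) : ℂ) = (v g / v 0 : ℝ) := by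
  have h0 : v 0 ≠ 0 := by
    intro h0
    refine hv (ContinuousMap.ext fun g => ?_)
    have := h g
    rcases this with h | h <;> simpa [h0] using h 0
  have habs : ∀ g, |v g / v 0| = 1 := by
    intro g
    rw [abs_div, div_eq_one_iff_eq (abs_ne_zero.mpr h0)]
    rcases h g with h | h <;> have := h 0 <;> rw [zero_add] at this <;> simp [this]
  have hmul : ∀ x g, v (x + g) / v 0 = (v x / v 0) * (v g / v 0) := by
    intro x g
    have hx := h g
    rcases hx with h | h
    · have h1 := h 0
      rw [zero_add] at h1
      rw [h, h1, div_self h0, mul_one]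
    · have h1 := h 0
      rw [zero_add] at h1
      rw [h, h1, neg_div, neg_div, div_self h0, mul_neg_one]
  let χ : Multiplicative G → Circle := fun x =>
    ⟨((v x.toAdd / v 0 : ℝ) : ℂ), by
      exact mem_sphere_zero_iff_norm.mpr
        (by rw [Complex.norm_real, Real.norm_eq_abs, habs])⟩
  have hχ : ∀ x, (χ x : ℂ) = ((v x.toAdd / v 0 : ℝ) : ℂ) := fun x => rfl
  let γ : Multiplicative G →ₜ* Circle :=
    { toFun := χ
      map_one' := by
        ext
        rw [hχ, toAdd_one, div_self h0]; simp
      map_mul' := fun x y => by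
        ext
        rw [Circle.coe_mul, hχ, hχ, hχ, toAdd_mul, hmul]; push_cast; rfl
      continuous_toFun := by
        refine Continuous.subtype_mk ?_ _
        exact Complex.continuous_ofReal.comp ((v.continuous.comp continuous_toAdd).div_const _) }
  exact ⟨γ, fun g => hχ _⟩

/-- The real form of a character; in exponent two all characters are real. -/
noncomputable def realChar (γ : Dual G) : C(G, ℝ) :=
  ⟨fun x => (γ (Multiplicative.ofAdd x) : ℂ).re, by
    have : Continuous γ := map_continuous γ
    have h : Continuous fun x : G => γ (Multiplicative.ofAdd x) := this.comp continuous_ofAdd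
    exact Complex.continuous_re.comp (continuous_subtype_val.comp h)⟩

lemma ofReal_realChar (h2 : ∀ x : G, x + x = 0) (γ : Dual G) (x : G) :
    ((realChar γ x : ℝ) : ℂ) = γ (Multiplicative.ofAdd x) := by
  have h : (γ (Multiplicative.ofAdd x) : ℂ) * γ (Multiplicative.ofAdd x) = 1 := by
    rw [← Circle.coe_mul, ← map_mul, ← ofAdd_add, h2, ofAdd_zero, map_one, Circle.coe_one]
  change (((γ (Multiplicative.ofAdd x) : ℂ).re : ℝ) : ℂ) = _
  rcases mul_self_eq_one_iff.mp h with h | h <;> rw [h] <;> simp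

lemma realChar_mul (h2 : ∀ x : G, x + x = 0) (γ δ : Dual G) :
    realChar (γ * δ) = realChar γ * realChar δ := by
  ext x
  rw [← Complex.ofReal_inj, ofReal_realChar h2, ContinuousMap.mul_apply, Complex.ofReal_mul,
    ofReal_realChar h2, ofReal_realChar h2]
  rfl

lemma realChar_one : realChar (1 : Dual G) = 1 := by
  ext x
  simp [realChar]

lemma dual_mul_self (h2 : ∀ x : G, x + x = 0) (γ : Dual G) : γ * γ = 1 := by
  refine PontryaginDual.ext fun x => ?_
  change γ x * γ x = 1
  rw [← map_mul]
  have : x * x = 1 := h2 x.toAdd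
  rw [this, map_one]

/-- Translation of continuous functions by `g`. -/
def translation [IsTopologicalAddGroup G] (g : G) : C(G, ℝ) →ₗ[ℝ] C(G, ℝ) where
  toFun v := v.comp ⟨fun x => x + g, continuous_add_const g⟩
  map_add' _ _ := rfl
  map_smul' _ _ := rfl

lemma translation_apply [IsTopologicalAddGroup G] (g x : G) (v : C(G, ℝ)) : translation g v x = v (x + g) := rfl

end Characters

section Compact

variable {G : Type*} [AddCommGroup G] [TopologicalSpace G] [IsTopologicalAddGroup G]
  [CompactSpace G] [MeasurableSpace G] [BorelSpace G]

instance : IsProbabilityMeasure (haarProb G) :=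
  ⟨by rw [← TopologicalSpace.PositiveCompacts.coe_top]; exact Measure.addHaarMeasure_self⟩

instance : (haarProb G).IsAddHaarMeasure :=
  inferInstanceAs (Measure.addHaarMeasure (⊤ : TopologicalSpace.PositiveCompacts G)).IsAddHaarMeasure

instance : (haarProb G).Regular :=
  inferInstanceAs (Measure.addHaarMeasure (⊤ : TopologicalSpace.PositiveCompacts G)).Regular

/-- Continuous eigenfunctions of the integral operator with kernel `u (x + y)`. -/
noncomputable def eigenfunctions (u : C(G, ℝ)) (l : ℝ) : Submodule ℝ C(G, ℝ) :=
  LinearMap.ker (((SumKernel.toCont (haarProb G) u).comp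
    (ContinuousMap.toLp 2 (haarProb G) ℝ) : C(G, ℝ) →ₗ[ℝ] C(G, ℝ)) - l • LinearMap.id)

lemma mem_eigenfunctions {u : C(G, ℝ)} {l : ℝ} {v : C(G, ℝ)} :
    v ∈ eigenfunctions u l ↔
      SumKernel.toCont (haarProb G) u (ContinuousMap.toLp 2 (haarProb G) ℝ v) = l • v := by
  simp [eigenfunctions, sub_eq_zero]

lemma integral_of_mem_eigenfunctions {u : C(G, ℝ)} {l : ℝ} {v : C(G, ℝ)}
    (hv : v ∈ eigenfunctions u l) (x : G) : ∫ y, u (x + y) * v y ∂(haarProb G) = l * v x := by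
  rw [← SumKernel.toCont_toLp, mem_eigenfunctions.mp hv]; rfl

lemma translation_mem_eigenfunctions (h2 : ∀ x : G, x + x = 0) {u : C(G, ℝ)} {l : ℝ}
    {v : C(G, ℝ)} (hv : v ∈ eigenfunctions u l) (g : G) :
    translation g v ∈ eigenfunctions u l := by
  rw [mem_eigenfunctions]
  ext x
  rw [SumKernel.toCont_toLp, ← integral_add_right_eq_self _ g]
  simp only [translation_apply, ContinuousMap.smul_apply, smul_eq_mul, add_assoc, h2, add_zero]
  rw [← integral_of_mem_eigenfunctions hv]
  refine integral_congr_ae (Filter.Eventually.of_forall fun y => ?_)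
  simp only [add_assoc, add_comm g y]

lemma finiteDimensional_eigenfunctions [T2Space G] (u : C(G, ℝ)) {l : ℝ} (hl : l ≠ 0) :
    FiniteDimensional ℝ (eigenfunctions u l) := by
  have := ContinuousLinearMap.finite_dimensional_eigenspace
    (SumKernel.isCompactOperator_op (haarProb G) u) l hl
  have hmem : ∀ v ∈ eigenfunctions u l,
      (ContinuousMap.toLp (E := ℝ) 2 (haarProb G) ℝ).toLinearMap v ∈
        Module.End.eigenspace (SumKernel.op (haarProb G) u).toLinearMap l := by
    intro v hv
    rw [Module.End.mem_eigenspace_iff]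
    change ContinuousMap.toLp 2 (haarProb G) ℝ (SumKernel.toCont (haarProb G) u
      (ContinuousMap.toLp 2 (haarProb G) ℝ v)) = _
    rw [mem_eigenfunctions.mp hv, map_smul]
    rfl
  refine FiniteDimensional.of_injective (LinearMap.restrict _ hmem) fun v w hvw => ?_
  exact Subtype.ext (ContinuousMap.toLp_injective (haarProb G) (congrArg Subtype.val hvw))

/-- A nonzero kernel has a nonzero continuous eigenfunction for a nonzero eigenvalue. -/
lemma exists_eigenfunctions_ne_bot [T2Space G] {u : C(G, ℝ)} (hu : u ≠ 0) :
    ∃ l : ℝ, l ≠ 0 ∧ eigenfunctions u l ≠ ⊥ := by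
  have hop : SumKernel.op (haarProb G) u ≠ 0 := by
    intro h
    have h1 : SumKernel.op (haarProb G) u (ContinuousMap.toLp 2 (haarProb G) ℝ u) = 0 := by
      rw [h]; rfl
    have h3 : SumKernel.toCont (haarProb G) u (ContinuousMap.toLp 2 (haarProb G) ℝ u) = 0 :=
      ContinuousMap.toLp_injective (𝕜 := ℝ) (p := 2) (haarProb G) (h1.trans (map_zero _).symm)
    have h4 := congrArg (fun w : C(G, ℝ) => w 0) h3
    simp only [SumKernel.toCont_toLp, zero_add, ContinuousMap.zero_apply] at h4
    have h5 := ContinuousMap.inner_toLp (haarProb G) u u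
    simp only [conj_trivial, h4, inner_self_eq_zero] at h5
    exact hu (ContinuousMap.toLp_injective (𝕜 := ℝ) (p := 2) (haarProb G)
      (h5.trans (map_zero _).symm))
  have hne := mt (ContinuousLinearMap.eq_zero_of_forall_hasEigenvalue_eq_zero
    (SumKernel.isCompactOperator_op (haarProb G) u)
    (SumKernel.isSymmetric_op (haarProb G) u)).mp hop
  push Not at hne
  obtain ⟨l, hl, hl0⟩ := hne
  refine ⟨l, hl0, fun hbot => ?_⟩
  obtain ⟨f, hf⟩ := hl.exists_hasEigenvector
  have hf1 : SumKernel.op (haarProb G) u f = l • f := hf.apply_eq_smul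
  have hmem : SumKernel.toCont (haarProb G) u f ∈ eigenfunctions u l := by
    rw [mem_eigenfunctions]
    change SumKernel.toCont (haarProb G) u (SumKernel.op (haarProb G) u f) = _
    rw [hf1, map_smul]
  rw [hbot, Submodule.mem_bot] at hmem
  have h0 : SumKernel.op (haarProb G) u f = 0 := by
    change ContinuousMap.toLp 2 (haarProb G) ℝ (SumKernel.toCont (haarProb G) u f) = 0
    rw [hmem, map_zero]
  rw [h0] at hf1
  exact hf.2 ((smul_eq_zero.mp hf1.symm).resolve_left hl0)

/-- The characters of a compact Hausdorff group of exponent two separate points. -/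
theorem exists_dual_eq_neg_one [T2Space G] (h2 : ∀ x : G, x + x = 0) {g : G} (hg : g ≠ 0) :
    ∃ γ : Dual G, (γ (Multiplicative.ofAdd g) : ℂ) = -1 := by
  obtain ⟨φ, hφ0, hφ1, -⟩ := exists_continuous_zero_one_of_isClosed (X := G) (s := {0}) (t := {g})
    isClosed_singleton isClosed_singleton (by simpa using hg.symm)
  -- a kernel that is odd under translation by `g`, so that its eigenfunctions are odd too
  let u : C(G, ℝ) := φ - translation g φ
  have hug : ∀ x, u (x + g) = -u x := by
    intro x
    simp only [u, ContinuousMap.sub_apply, translation_apply, add_assoc, h2, add_zero]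
    ring
  have hu : u ≠ 0 := by
    intro h
    have := congrArg (fun w : C(G, ℝ) => w 0) h
    simp [u, translation_apply, hφ0 (Set.mem_singleton _), hφ1 (Set.mem_singleton _)] at this
  obtain ⟨l, hl, hE⟩ := exists_eigenfunctions_ne_bot hu
  have := finiteDimensional_eigenfunctions u hl
  obtain ⟨v, hv, hv0, hvs⟩ := exists_common_eigenvector (translation (G := G))
    (fun g v => by ext x; simp only [translation_apply, add_assoc, h2, add_zero])
    (fun g h v => by ext x; simp only [translation_apply, add_assoc, add_comm g h])
    _ (eigenfunctions u l) le_rfl hE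
    (fun g v hv => translation_mem_eigenfunctions h2 hv g)
  obtain ⟨γ, hγ⟩ := exists_dual_of_translate_eq_or v hv0 fun h => (hvs h).imp
    (fun e x => by rw [← translation_apply, e]) (fun e x => by rw [← translation_apply, e]; rfl)
  refine ⟨γ, ?_⟩
  have hodd : ∀ x, v (x + g) = -v x := by
    intro x
    have h1 := integral_of_mem_eigenfunctions hv (x + g)
    have h3 := integral_of_mem_eigenfunctions hv x
    have h4 : ∀ y, u (x + g + y) = -u (x + y) := fun y => by
      rw [add_right_comm, hug]
    simp only [h4, neg_mul, integral_neg, h3] at h1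
    exact mul_left_cancel₀ hl (by linarith)
  have hv00 : v 0 ≠ 0 := by
    intro h0
    have := hγ 0
    rw [h0] at this
    simp at this
  have := hodd 0
  rw [zero_add] at this
  rw [hγ, this, neg_div, div_self hv00]
  simp

/-! ### The Walsh system of characters -/

lemma integral_realChar (h2 : ∀ x : G, x + x = 0) {γ : Dual G} (hγ : γ ≠ 1) :
    ∫ x, realChar γ x ∂(haarProb G) = 0 := by
  obtain ⟨g, hg⟩ : ∃ g : G, γ (Multiplicative.ofAdd g) ≠ 1 := by
    by_contra! h
    exact hγ (PontryaginDual.ext fun x => (h x.toAdd).trans rfl)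
  have hadd : ∀ x, realChar γ (x + g) = realChar γ x * realChar γ g := by
    intro x
    rw [← Complex.ofReal_inj, Complex.ofReal_mul, ofReal_realChar h2, ofReal_realChar h2,
      ofReal_realChar h2, ofAdd_add, map_mul, Circle.coe_mul]
  have hne : realChar γ g ≠ 1 := by
    intro h
    apply hg
    ext
    rw [← ofReal_realChar h2, h]
    simp
  have h := integral_add_right_eq_self (μ := haarProb G) (realChar γ) g
  simp only [hadd, integral_mul_const] at h
  have : (∫ x, realChar γ x ∂(haarProb G)) * (realChar γ g - 1) = 0 := by linarith
  exact (mul_eq_zero.mp this).resolve_right (sub_ne_zero.mpr hne)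

lemma orthonormal_realChar (h2 : ∀ x : G, x + x = 0) :
    Orthonormal ℝ fun γ : Dual G => ContinuousMap.toLp (E := ℝ) 2 (haarProb G) ℝ (realChar γ) := by
  classical
  rw [orthonormal_iff_ite]
  intro γ δ
  rw [ContinuousMap.inner_toLp]
  have : ∀ x, realChar δ x * (starRingEnd ℝ) (realChar γ x) = realChar (δ * γ) x := fun x => by
    rw [realChar_mul h2]; simp
  simp only [this]
  split_ifs with h
  · rw [h, dual_mul_self h2, realChar_one]; simp
  · refine integral_realChar h2 fun h1 => h ?_
    rw [← one_mul γ, ← h1, mul_assoc, dual_mul_self h2, mul_one]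

/-- Density of the trigonometric polynomials, by the Stone–Weierstrass theorem. -/
lemma span_realChar_closure_eq_top [T2Space G] (h2 : ∀ x : G, x + x = 0) :
    (Submodule.span ℝ (Set.range (realChar : Dual G → C(G, ℝ)))).topologicalClosure = ⊤ := by
  have hspan : Subalgebra.toSubmodule (Algebra.adjoin ℝ (Set.range (realChar : Dual G → C(G, ℝ))))
      = Submodule.span ℝ (Set.range realChar) := by
    refine Algebra.adjoin_eq_span_of_subset ℝ (Set.Subset.trans ?_ Submodule.subset_span)
    intro v hv
    refine Submonoid.closure_induction (fun _ => id) ⟨1, realChar_one⟩ ?_ hv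
    rintro _ _ _ _ ⟨γ, rfl⟩ ⟨δ, rfl⟩
    exact ⟨γ * δ, realChar_mul h2 γ δ⟩
  have hsep : (Algebra.adjoin ℝ (Set.range (realChar : Dual G → C(G, ℝ)))).SeparatesPoints := by
    intro x y hxy
    have hne : x + y ≠ 0 := fun h => hxy (by
      rw [← add_zero x, ← h2 y, ← add_assoc, h, zero_add])
    obtain ⟨γ, hγ⟩ := exists_dual_eq_neg_one h2 hne
    refine ⟨_, ⟨realChar γ, Algebra.subset_adjoin ⟨γ, rfl⟩, rfl⟩, fun h => ?_⟩
    have h1 : (realChar γ x : ℂ) * realChar γ y = -1 := by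
      rw [ofReal_realChar h2, ofReal_realChar h2, ← Circle.coe_mul, ← map_mul, ← ofAdd_add, hγ]
    change realChar γ x = realChar γ y at h
    rw [h] at h1
    have h3 : realChar γ y * realChar γ y = -1 := by exact_mod_cast h1
    nlinarith [mul_self_nonneg (realChar γ y)]
  rw [← hspan]
  exact congrArg Subalgebra.toSubmodule
    (ContinuousMap.subalgebra_topologicalClosure_eq_top_of_separatesPoints _ hsep)

lemma span_toLp_realChar_closure_eq_top [T2Space G] (h2 : ∀ x : G, x + x = 0) :
    (Submodule.span ℝ (Set.range fun γ : Dual G =>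
      ContinuousMap.toLp (E := ℝ) 2 (haarProb G) ℝ (realChar γ))).topologicalClosure = ⊤ := by
  have h := (ContinuousMap.toLp_denseRange ℝ (haarProb G) ℝ
    (p := 2) (by norm_num)).topologicalClosure_map_submodule (span_realChar_closure_eq_top h2)
  rw [Submodule.map_span, ← Set.range_comp] at h
  exact h

/-- Parseval's identity for indicator functions. -/
lemma hasSum_setIntegral_realChar_mul [T2Space G] (h2 : ∀ x : G, x + x = 0) {A B : Set G}
    (hA : MeasurableSet A) (hB : MeasurableSet B) :
    HasSum (fun γ : Dual G => (∫ x in A, realChar γ x ∂(haarProb G)) *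
      ∫ x in B, realChar γ x ∂(haarProb G)) ((haarProb G).real (A ∩ B)) := by
  let b : HilbertBasis (Dual G) ℝ (Lp ℝ 2 (haarProb G)) :=
    HilbertBasis.mk (orthonormal_realChar h2) (span_toLp_realChar_closure_eq_top h2).ge
  have hb : ∀ γ, b γ = ContinuousMap.toLp (E := ℝ) 2 (haarProb G) ℝ (realChar γ) := fun γ => by
    simp only [b, HilbertBasis.coe_mk]
  have hcoeff : ∀ (C : Set G) (hC : MeasurableSet C) (γ : Dual G),
      inner ℝ (indicatorConstLp 2 hC (measure_ne_top (haarProb G) C) (1 : ℝ)) (b γ)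
        = ∫ x in C, realChar γ x ∂(haarProb G) := by
    intro C hC γ
    rw [L2.inner_indicatorConstLp_one, hb]
    exact integral_congr_ae (ae_restrict_of_ae (ContinuousMap.coeFn_toLp _ _))
  have h := b.hasSum_inner_mul_inner
    (indicatorConstLp 2 hA (measure_ne_top (haarProb G) A) (1 : ℝ))
    (indicatorConstLp 2 hB (measure_ne_top (haarProb G) B) (1 : ℝ))
  rw [L2.inner_indicatorConstLp_indicatorConstLp] at h
  have hcomm : ∀ γ, inner ℝ (b γ) (indicatorConstLp 2 hB (measure_ne_top (haarProb G) B) (1 : ℝ))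
      = ∫ x in B, realChar γ x ∂(haarProb G) := fun γ => by
    rw [real_inner_comm, hcoeff]
  simp only [hcoeff, hcomm] at h
  simpa using h

/-- The characters of a compact Hausdorff group of exponent two, as a Walsh system. -/
noncomputable def walshSystem [T2Space G] (h2 : ∀ x : G, x + x = 0) :
    WalshSystem (haarProb G) (Dual G) where
  char :=
    { toFun := fun γ => realChar γ
      map_one' := by rw [realChar_one]; rfl
      map_mul' := fun γ δ => by rw [realChar_mul h2]; rfl }
  mul_self := dual_mul_self h2
  measurable_char γ := (realChar γ).continuous.measurable
  integral_char _ hγ := integral_realChar h2 hγ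
  hasSum_setIntegral_mul _ _ hA hB := hasSum_setIntegral_realChar_mul h2 hA hB

lemma dualTransform_chi [T2Space G] (h2 : ∀ x : G, x + x = 0) {A : Set G} (hA : MeasurableSet A)
    (γ : Dual G) : dualTransform (chi A) γ = ((walshSystem h2).coeff A γ : ℂ) := by
  have h : ∀ x, chi A x * (starRingEnd ℂ) (γ (Multiplicative.ofAdd x) : ℂ)
      = A.indicator (fun x => ((realChar γ x : ℝ) : ℂ)) x := by
    intro x
    rw [← ofReal_realChar h2, Complex.conj_ofReal]
    by_cases hx : x ∈ A <;> simp [chi, hx]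
  rw [dualTransform]
  simp only [h]
  rw [integral_indicator hA, integral_complex_ofReal]
  rfl

lemma algNorm_chi [T2Space G] (h2 : ∀ x : G, x + x = 0) {A : Set G} (hA : MeasurableSet A) :
    algNorm (chi A) = ∑' γ, ENNReal.ofReal |(walshSystem h2).coeff A γ| := by
  rw [algNorm]
  congr 1
  ext γ
  rw [dualTransform_chi h2 hA, ← ofReal_norm, Complex.norm_real, Real.norm_eq_abs]

lemma algNorm_congr_ae {f g : G → ℂ} (h : f =ᵐ[haarProb G] g) : algNorm f = algNorm g := by
  rw [algNorm, algNorm]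
  congr 1
  ext γ
  rw [dualTransform, dualTransform]
  congr 1
  refine integral_congr_ae ?_
  filter_upwards [h] with x hx
  rw [hx]

/-- The lower bound for the Fourier algebra norm; when the coefficients are not summable the norm is
`∞`. A null-measurable set may be replaced by a measurable one. -/
theorem ofReal_log_log_le_algNorm [T2Space G] (h2 : ∀ x : G, x + x = 0) {A : Set G}
    (hA : NullMeasurableSet A (haarProb G)) {ε : ℝ} (hε0 : 0 < ε) (hε1 : ε < 1 / 3)
    (hε : |(haarProb G).real A - 1 / 3| ≤ ε) :
    ENNReal.ofReal (1 / (66 * Real.log 2) * Real.log (Real.log ε⁻¹)) ≤ algNorm (chi A) := by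
  obtain ⟨B, hB, hAB⟩ : ∃ B, MeasurableSet B ∧ A =ᵐ[haarProb G] B :=
    ⟨_, measurableSet_toMeasurable _ A, hA.toMeasurable_ae_eq.symm⟩
  rw [algNorm_congr_ae (show chi A =ᵐ[haarProb G] chi B from indicator_ae_eq_of_ae_eq_set hAB),
    algNorm_chi h2 hB]
  rw [measureReal_congr hAB] at hε
  by_cases hsum : Summable fun γ => |(walshSystem h2).coeff B γ|
  · rw [← ENNReal.ofReal_tsum_of_nonneg (fun _ => abs_nonneg _) hsum]
    exact ENNReal.ofReal_le_ofReal ((walshSystem h2).log_log_le_tsum hB hsum hε0 hε1 hε)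
  · have htop : ∑' γ, ENNReal.ofReal |(walshSystem h2).coeff B γ| = ∞ := by
      by_contra hne
      refine hsum ((ENNReal.summable_toReal hne).congr fun γ => ?_)
      rw [ENNReal.toReal_ofReal (abs_nonneg _)]
    rw [htop]
    exact le_top

end Compact

end CompactF2

theorem theorem1p2 :
    ∃ c : ℝ, 0 < c ∧
      ∀ (G : Type*) [AddCommGroup G] [Module (ZMod 2) G] [TopologicalSpace G]
        [IsTopologicalAddGroup G] [CompactSpace G] [T2Space G] [MeasurableSpace G] [BorelSpace G]
        (A : Set G), NullMeasurableSet A (CompactF2.haarProb G) →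
        (∀ ε : ℝ, 0 < ε → ε < 1 / 3 → |(CompactF2.haarProb G).real A - 1 / 3| ≤ ε →
          ENNReal.ofReal (c * Real.log (Real.log ε⁻¹)) ≤ CompactF2.algNorm (CompactF2.chi A)) ∧
        ((CompactF2.haarProb G).real A = 1 / 3 → ¬ CompactF2.MemA (CompactF2.chi A)) := by
  have hc : 0 < 1 / (66 * Real.log 2) := by
    have := Real.log_pos (x := 2) (by norm_num)
    positivity
  refine ⟨1 / (66 * Real.log 2), hc, ?_⟩
  intro G _ _ _ _ _ _ _ _ A hA
  have h2 : ∀ x : G, x + x = 0 := ZModModule.add_self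
  refine ⟨fun ε hε0 hε1 hε => CompactF2.ofReal_log_log_le_algNorm h2 hA hε0 hε1 hε, ?_⟩
  rintro hthird ⟨-, hfin⟩
  -- let `ε = exp (-exp t)` with `t` chosen so that the bound exceeds the finite norm
  set M := (CompactF2.algNorm (CompactF2.chi A)).toReal
  have hM : 0 ≤ M := ENNReal.toReal_nonneg
  have ht : 0 ≤ (66 * Real.log 2) * (M + 1) := by
    have := Real.log_pos (x := 2) (by norm_num)
    positivity
  set t := (66 * Real.log 2) * (M + 1) + 1
  have hε1 : Real.exp (-Real.exp t) < 1 / 3 := by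
    rw [Real.exp_neg, inv_lt_comm₀ (Real.exp_pos _) (by norm_num)]
    have h1 := Real.add_one_le_exp t
    have h3 := Real.quadratic_le_exp_of_nonneg (Real.exp_pos t).le
    nlinarith
  have hb := CompactF2.ofReal_log_log_le_algNorm h2 hA (Real.exp_pos (-Real.exp t)) hε1
    (by rw [hthird, sub_self, abs_zero]; exact (Real.exp_pos _).le)
  rw [← Real.exp_neg, neg_neg, Real.log_exp, Real.log_exp,
    ENNReal.ofReal_le_iff_le_toReal hfin.ne] at hb
  have : M + 1 ≤ 1 / (66 * Real.log 2) * t := by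
    rw [one_div, le_inv_mul_iff₀ (by simpa using hc)]
    linarith
  linarith
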